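/- Corollary 1.2. Let $n\ge 3$ and let $V$ be a (complex-valued) potential in the Kato class $\mathcal{K}_n$, that is, $V\in L^1_{\rm loc}(\mathbb{R}^n)$ and $$\lim_{r\to0^+}\ \sup_{x\in\mathbb{R}^n}\int_{|x-y|<r}\frac{|V(y)|}{|x-y|^{n-2}}\,dy=0 .$$ Then there is a constant $\delta>0$, depending only on $n$ and $V$, with the following property. Let $u\in W^{2,2}(\mathbb{R}^n)$ be a (complex-valued) function, not almost everywhere zero, such that $|\Delta u(x)|\le|V(x)u(x)|$ for almost every $x\in\mathbb{R}^n$, where $\Delta u$ is taken in the weak sense. If the support of $u$ (the complement of the largest open set on which $u=0$ almost everywhere) is contained in a ball $B(a,r)$ with $a\in\mathbb{R}^n$ and $r>0$, then $|B(a,r)|\ge\delta$. -/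

import Mathlib

open MeasureTheory Filter Topology Set
open scoped ENNReal ContDiff

namespace MinSupp

/-- `g` is the weak `i`-th partial derivative of `u` on `ℝⁿ`: both functions are locally integrable
and `∫ (∂ᵢφ) u = - ∫ φ g` for every real test function `φ ∈ C_c^∞(ℝⁿ)`. -/
def HasWeakPartialDeriv {n : ℕ} (i : Fin n) (u g : EuclideanSpace ℝ (Fin n) → ℂ) : Prop :=
  LocallyIntegrable u volume ∧ LocallyIntegrable g volume ∧
    ∀ φ : EuclideanSpace ℝ (Fin n) → ℝ, ContDiff ℝ ∞ φ → HasCompactSupport φ →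
      ∫ x, (fderiv ℝ φ x (EuclideanSpace.single i 1)) • u x = - ∫ x, φ x • g x

/-- The Sobolev space `W^{m,p}(ℝⁿ)`: the (complex-valued) functions all of whose weak derivatives
up to order `m` exist and belong to `L^p(ℝⁿ)`. -/
def MemSobolevW {n : ℕ} (p : ℝ≥0∞) : ℕ → (EuclideanSpace ℝ (Fin n) → ℂ) → Prop
  | 0, u => MemLp u p volume
  | m + 1, u => MemLp u p volume ∧ ∀ i : Fin n, ∃ g : EuclideanSpace ℝ (Fin n) → ℂ,
      HasWeakPartialDeriv i u g ∧ MemSobolevW p m g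

/-- `w` is the Laplacian `∑ᵢ ∂ᵢ∂ᵢ u` of `u`, the derivatives being taken in the weak sense. -/
def IsWeakLaplacian {n : ℕ} (u w : EuclideanSpace ℝ (Fin n) → ℂ) : Prop :=
  ∃ h : Fin n → EuclideanSpace ℝ (Fin n) → ℂ,
    (∀ i, ∃ g : EuclideanSpace ℝ (Fin n) → ℂ,
      HasWeakPartialDeriv i u g ∧ HasWeakPartialDeriv i g (h i)) ∧
    ∀ᵐ x ∂volume, w x = ∑ i, h i x

/-- `u` solves the differential inequality `|Δu| ≤ |Vu|` almost everywhere on `ℝⁿ`. -/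
def SolvesLaplacianIneq {n : ℕ} (V u : EuclideanSpace ℝ (Fin n) → ℂ) : Prop :=
  ∃ w : EuclideanSpace ℝ (Fin n) → ℂ, IsWeakLaplacian u w ∧
    ∀ᵐ x ∂volume, ‖w x‖ ≤ ‖V x * u x‖

/-- The (essential) support of a function defined up to null sets: the complement of the largest
open set on which it vanishes almost everywhere. -/
def essSupport {n : ℕ} (u : EuclideanSpace ℝ (Fin n) → ℂ) : Set (EuclideanSpace ℝ (Fin n)) :=
  {x | ∀ U ∈ 𝓝 x, ¬ (∀ᵐ y ∂(volume.restrict U), u y = 0)}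

/-- `η(r, V) = sup_x ∫_{|x-y|<r} |V(y)| / |x-y|^{n-2} dy`, with values in `[0, ∞]`. -/
noncomputable def katoEta {n : ℕ} (r : ℝ) (V : EuclideanSpace ℝ (Fin n) → ℂ) : ℝ≥0∞ :=
  ⨆ x : EuclideanSpace ℝ (Fin n),
    ∫⁻ y in Metric.ball x r, ‖V y‖ₑ / ‖x - y‖ₑ ^ (n - 2) ∂volume

/-- The Kato class on `ℝⁿ` (for `n ≥ 3`): `V ∈ L¹_loc` with `η(r, V) → 0` as `r → 0⁺`. -/
def KatoClass {n : ℕ} (V : EuclideanSpace ℝ (Fin n) → ℂ) : Prop :=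
  LocallyIntegrable V volume ∧ Tendsto (fun r : ℝ => katoEta r V) (𝓝[>] 0) (𝓝 0)

end MinSupp

/-! Write `w` for the weak Laplacian of `u`. Since `u` lives in a ball, it is dominated almost
everywhere by a constant `C = C(n)` times the Newtonian potential of `|w|`
(`exists_enorm_le_newtonian_potential`). Multiplying by `|V|`, integrating over the ball and
exchanging integrals (`lintegral_mul_newtonian_potential_le`) gives `‖w‖₁ ≤ C η(2r, V) ‖w‖₁`. If `C
η(2r, V) < 1` then `w = 0`, and the potential bound forces `u = 0`. The Kato condition makes `C
η(2r, V) < 1` for all small `r`, so a nontrivial `u` needs a ball of radius bounded below.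

The potential bound avoids singular kernels: `w` is tested against `(|y - x|² + e²)^((2-n)/2)`,
whose Laplacian is a negative multiple of a rescaled integrable bump, and `e → 0` in `L¹`. -/

namespace MinSupp

/-! ### Approximate identities in `L¹` -/

/-- Translations are continuous in `L¹`. -/
theorem tendsto_lintegral_enorm_translate_sub {n : ℕ} {u : EuclideanSpace ℝ (Fin n) → ℂ}
    (hu : Integrable u volume) :
    Tendsto (fun h : EuclideanSpace ℝ (Fin n) => ∫⁻ x, ‖u (x - h) - u x‖ₑ) (𝓝 0) (𝓝 0) := by
  have hm : MemLp u 1 volume := memLp_one_iff_integrable.2 hu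
  let T : EuclideanSpace ℝ (Fin n) → Lp ℂ 1 (volume : Measure (EuclideanSpace ℝ (Fin n))) :=
    fun h => DomAddAct.mk (-h) +ᵥ hm.toLp
  have hT : Continuous T := by
    have : Continuous fun h : EuclideanSpace ℝ (Fin n) => DomAddAct.mk (-h) :=
      DomAddAct.mkHomeomorph.continuous.comp continuous_neg
    have _ : Fact ((1 : ℝ≥0∞) ≠ ⊤) := ⟨ENNReal.one_ne_top⟩
    exact this.vadd continuous_const
  have h0 : T 0 = hm.toLp := by simp [T]
  have hlim : Tendsto (fun h => edist (T h) (T 0)) (𝓝 0) (𝓝 0) := by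
    have := (hT.tendsto 0).edist (tendsto_const_nhds (x := T 0))
    simpa using this
  refine hlim.congr fun h => ?_
  rw [h0, Lp.edist_def, eLpNorm_one_eq_lintegral_enorm]
  refine lintegral_congr_ae ?_
  have h1 : (T h : EuclideanSpace ℝ (Fin n) → ℂ) =ᵐ[volume] fun x => u (-h +ᵥ x) := by
    have := (hm.comp_measurePreserving (measurePreserving_vadd (-h) volume)).coeFn_toLp
    exact this
  filter_upwards [h1, hm.coeFn_toLp] with x hx hx'
  simp only [Pi.sub_apply, hx, hx', vadd_eq_add]
  congr 3
  abel_nf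

/-- The convolutions of `u` with the rescalings of an integrable kernel converge in `L¹`. -/
theorem tendsto_lintegral_enorm_rescaled_convolution_sub {n : ℕ}
    {u : EuclideanSpace ℝ (Fin n) → ℂ} {K : EuclideanSpace ℝ (Fin n) → ℝ}
    (hum : Measurable u) (hu : Integrable u volume) (hK : Continuous K) (hKi : Integrable K volume)
    (hK1 : ∀ z, ‖K z‖ ≤ 1) :
    Tendsto (fun e : ℝ => ∫⁻ x, ‖(∫ z, K z • u (x - e • z)) - (∫ z, K z) • u x‖ₑ)
      (𝓝[>] 0) (𝓝 0) := by
  let G : EuclideanSpace ℝ (Fin n) → ℝ≥0∞ := fun h => ∫⁻ x, ‖u (x - h) - u x‖ₑ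
  have hGm : Measurable G := by
    have : Measurable (Function.uncurry fun h x : EuclideanSpace ℝ (Fin n) =>
        ‖u (x - h) - u x‖ₑ) := by fun_prop
    exact this.lintegral_prod_right
  -- Uniform in `h`, so a multiple of `‖K‖ₑ` dominates the integrands below.
  have hGb (h) : G h ≤ 2 * ∫⁻ x, ‖u x‖ₑ := by
    calc G h ≤ ∫⁻ x, (‖u (x - h)‖ₑ + ‖u x‖ₑ) := lintegral_mono fun x => enorm_sub_le
      _ = 2 * ∫⁻ x, ‖u x‖ₑ := by
        rw [lintegral_add_right _ (by fun_prop), lintegral_sub_right_eq_self (fun x => ‖u x‖ₑ) h,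
          two_mul]
  have hlim : Tendsto (fun e : ℝ => ∫⁻ z, ‖K z‖ₑ * G (e • z)) (𝓝[>] 0) (𝓝 0) := by
    have key := tendsto_lintegral_filter_of_dominated_convergence (μ := volume) (l := 𝓝[>] (0 : ℝ))
      (F := fun e z => ‖K z‖ₑ * G (e • z)) (f := fun _ => 0)
      (fun z => ‖K z‖ₑ * (2 * ∫⁻ x, ‖u x‖ₑ))
      (Eventually.of_forall fun e => by fun_prop)
      (Eventually.of_forall fun e => Eventually.of_forall fun z => by gcongr; exact hGb _) ?_ ?_
    · simpa using key
    · rw [lintegral_mul_const _ (by fun_prop)]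
      exact ENNReal.mul_ne_top hKi.2.ne (ENNReal.mul_ne_top (by simp) hu.2.ne)
    · refine Eventually.of_forall fun z => ?_
      have h1 : Tendsto (fun e : ℝ => e • z) (𝓝[>] 0) (𝓝 0) := by
        have : Tendsto (fun e : ℝ => e • z) (𝓝 0) (𝓝 ((0 : ℝ) • z)) :=
          (continuous_id.smul continuous_const).tendsto 0
        rw [zero_smul] at this
        exact this.mono_left nhdsWithin_le_nhds
      have h2 := (tendsto_lintegral_enorm_translate_sub hu).comp h1
      simpa using ENNReal.Tendsto.const_mul h2 (Or.inr (by simp : ‖K z‖ₑ ≠ ⊤))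
  refine tendsto_of_tendsto_of_tendsto_of_le_of_le' tendsto_const_nhds hlim
    (Eventually.of_forall fun _ => zero_le) ?_
  filter_upwards [self_mem_nhdsWithin] with e (he : 0 < e)
  calc ∫⁻ x, ‖(∫ z, K z • u (x - e • z)) - (∫ z, K z) • u x‖ₑ
      ≤ ∫⁻ x, ∫⁻ z, ‖K z‖ₑ * ‖u (x - e • z) - u x‖ₑ := by
        refine lintegral_mono fun x => ?_
        have hi : Integrable (fun z => u (x - e • z)) volume :=
          (hu.comp_sub_left x).comp_smul he.ne'
        rw [← integral_smul_const, ← integral_sub]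
        · refine (enorm_integral_le_lintegral_enorm _).trans (lintegral_mono fun z => ?_)
          rw [← smul_sub, enorm_smul]
        · exact hi.bdd_smul 1 hK.aestronglyMeasurable (Eventually.of_forall hK1)
        · exact hKi.smul_const _
    _ = ∫⁻ z, ∫⁻ x, ‖K z‖ₑ * ‖u (x - e • z) - u x‖ₑ := by
        refine lintegral_lintegral_swap ?_
        have hKm := hK.measurable
        exact Measurable.aemeasurable (by fun_prop)
    _ = ∫⁻ z, ‖K z‖ₑ * G (e • z) := by
        refine lintegral_congr fun z => ?_
        rw [lintegral_const_mul _ (by fun_prop)]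

/-- A bound which holds for all rescaled convolutions passes to the limit. -/
theorem ae_enorm_le_of_rescaled_convolution_le {n : ℕ}
    {u : EuclideanSpace ℝ (Fin n) → ℂ} {K : EuclideanSpace ℝ (Fin n) → ℝ}
    (hu : Integrable u volume) (hK : Continuous K) (hKi : Integrable K volume)
    (hK1 : ∀ z, ‖K z‖ ≤ 1) {N : EuclideanSpace ℝ (Fin n) → ℝ≥0∞} (hN : AEMeasurable N volume)
    (h : ∀ e : ℝ, 0 < e → ∀ x, ‖∫ z, K z • u (x - e • z)‖ₑ ≤ N x) :
    ∀ᵐ x, ‖(∫ z, K z) • u x‖ₑ ≤ N x := by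
  -- The exchange of integrals behind the convergence needs a genuinely measurable representative.
  obtain ⟨v, hvm, hv⟩ := hu.1
  have hvi : Integrable v volume := hu.congr hv
  have hvb : ∀ e : ℝ, 0 < e → ∀ x, ‖∫ z, K z • v (x - e • z)‖ₑ ≤ N x := by
    intro e he x
    refine le_trans (le_of_eq ?_) (h e he x)
    congr 1
    refine integral_congr_ae ?_
    have hq : Measure.QuasiMeasurePreserving (fun z : EuclideanSpace ℝ (Fin n) => x - e • z) := by
      refine (Measure.measurePreserving_sub_left volume x).quasiMeasurePreserving.comp
        ⟨measurable_const_smul e, ?_⟩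
      rw [Measure.map_addHaar_smul _ he.ne']
      exact Measure.smul_absolutelyContinuous
    filter_upwards [hq.ae hv] with z hz
    rw [hz]
  have hlim := tendsto_lintegral_enorm_rescaled_convolution_sub hvm.measurable hvi hK hKi hK1
  -- Truncated subtraction: only the excess over `N` is integrated, and the `L¹` error bounds it for
  -- every `e`.
  have hz : ∫⁻ x, (‖(∫ z, K z) • v x‖ₑ - N x) = 0 := by
    refine le_antisymm (ge_of_tendsto hlim ?_) (zero_le)
    filter_upwards [self_mem_nhdsWithin] with e (he : 0 < e)
    refine lintegral_mono fun x => tsub_le_iff_left.2 ?_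
    calc ‖(∫ z, K z) • v x‖ₑ
        = ‖(∫ z, K z • v (x - e • z)) - ((∫ z, K z • v (x - e • z)) - (∫ z, K z) • v x)‖ₑ := by
          rw [sub_sub_cancel]
      _ ≤ _ := enorm_sub_le.trans (by gcongr; exact hvb e he x)
  rw [lintegral_eq_zero_iff' (by fun_prop)] at hz
  filter_upwards [hz, hv] with x hx hx'
  rw [hx']
  exact tsub_eq_zero_iff_le.1 hx

/-! ### Vanishing off the essential support -/

/-- A function vanishes almost everywhere outside of any set containing its essential support. -/
theorem ae_eq_zero_of_notMem_of_essSupport_subset {n : ℕ} {u : EuclideanSpace ℝ (Fin n) → ℂ}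
    {s : Set (EuclideanSpace ℝ (Fin n))} (h : essSupport u ⊆ s) : ∀ᵐ x, x ∉ s → u x = 0 := by
  rw [ae_iff]
  refine measure_null_of_locally_null _ fun x hx => ?_
  have hx' : x ∉ essSupport u := fun h' => hx fun hs => absurd (h h') hs
  simp only [essSupport, mem_ofPred_eq, not_forall, not_not] at hx'
  obtain ⟨U, hU, hUx⟩ := hx'
  obtain ⟨t, htU, hto, hxt⟩ := mem_nhds_iff.1 hU
  refine ⟨_, inter_mem_nhdsWithin _ (hto.mem_nhds hxt), ?_⟩
  have h2 := ae_restrict_of_ae_restrict_of_subset htU hUx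
  rw [ae_restrict_iff' hto.measurableSet, ae_iff] at h2
  refine measure_mono_null (fun y hy => ?_) h2
  simp only [mem_inter_iff, mem_ofPred_eq, Classical.not_imp] at hy ⊢
  exact ⟨hy.2, hy.1.2⟩

/-! ### Calculus of the regularized fundamental solution -/

theorem hasFDerivAt_norm_sub_sq_add {n : ℕ} (x y : EuclideanSpace ℝ (Fin n)) (c : ℝ) :
    HasFDerivAt (fun y => ‖y - x‖ ^ 2 + c) (2 • innerSL ℝ (y - x)) y := by
  have h := ((hasFDerivAt_id y).sub_const x).norm_sq
  simpa using h.add_const c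

/-- First partial derivatives of the regularized power `(|y - x|² + c)ˢ`. -/
theorem fderiv_rpow_norm_sub_sq_add {n : ℕ} (x y : EuclideanSpace ℝ (Fin n)) {c : ℝ} (hc : 0 < c)
    (s : ℝ) (i : Fin n) :
    fderiv ℝ (fun y => (‖y - x‖ ^ 2 + c) ^ s) y (EuclideanSpace.single i 1) =
      2 * s * ((y i - x i) * (‖y - x‖ ^ 2 + c) ^ (s - 1)) := by
  have hq : ‖y - x‖ ^ 2 + c ≠ 0 := by positivity
  rw [((hasFDerivAt_norm_sub_sq_add x y c).rpow_const (p := s) (Or.inl hq)).fderiv]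
  simp [EuclideanSpace.inner_single_right]
  ring

/-- Second partial derivatives of the regularized power `(|y - x|² + c)ˢ`. -/
theorem fderiv_fderiv_rpow_norm_sub_sq_add {n : ℕ} (x y : EuclideanSpace ℝ (Fin n)) {c : ℝ}
    (hc : 0 < c) (s : ℝ) (i : Fin n) :
    fderiv ℝ (fun z => fderiv ℝ (fun y => (‖y - x‖ ^ 2 + c) ^ s) z (EuclideanSpace.single i 1)) y
        (EuclideanSpace.single i 1) =
      2 * s * (‖y - x‖ ^ 2 + c) ^ (s - 1) +
        4 * s * (s - 1) * ((y i - x i) ^ 2 * (‖y - x‖ ^ 2 + c) ^ (s - 2)) := by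
  have hq : ‖y - x‖ ^ 2 + c ≠ 0 := by positivity
  have h1 : HasFDerivAt (fun z : EuclideanSpace ℝ (Fin n) => z i - x i)
      (EuclideanSpace.proj i : EuclideanSpace ℝ (Fin n) →L[ℝ] ℝ) y :=
    (EuclideanSpace.proj i : EuclideanSpace ℝ (Fin n) →L[ℝ] ℝ).hasFDerivAt.sub_const _
  have h2 := (hasFDerivAt_norm_sub_sq_add x y c).rpow_const (p := s - 1) (Or.inl hq)
  simp_rw [fderiv_rpow_norm_sub_sq_add x _ hc]
  rw [((h1.fun_mul h2).const_mul (2 * s)).fderiv]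
  simp [EuclideanSpace.inner_single_right, show s - 1 - 1 = s - 2 by ring]
  ring

/-- The Laplacian of the regularized fundamental solution. -/
theorem sum_fderiv_fderiv_rpow_norm_sub_sq_add {n : ℕ} (x y : EuclideanSpace ℝ (Fin n)) {c : ℝ}
    (hc : 0 < c) :
    ∑ i, fderiv ℝ (fun z => fderiv ℝ (fun y => (‖y - x‖ ^ 2 + c) ^ ((2 - n : ℝ) / 2)) z
        (EuclideanSpace.single i 1)) y (EuclideanSpace.single i 1) =
      -(n * (n - 2) * c * (‖y - x‖ ^ 2 + c) ^ (-(n + 2 : ℝ) / 2)) := by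
  have hq : 0 < ‖y - x‖ ^ 2 + c := by positivity
  simp_rw [fderiv_fderiv_rpow_norm_sub_sq_add x y hc]
  rw [Finset.sum_add_distrib, ← Finset.mul_sum, ← Finset.mul_sum, ← Finset.sum_mul]
  have hn : ∑ i, (y i - x i) ^ 2 = ‖y - x‖ ^ 2 := by
    rw [EuclideanSpace.real_norm_sq_eq]; rfl
  -- With `s = (2 - n) / 2` one has `2sn = -4s(s - 1)`, so the `‖y - x‖²` terms cancel and only the
  -- one with `c` survives.
  have e1 : (2 - n : ℝ) / 2 - 1 = -(n + 2 : ℝ) / 2 + 1 := by ring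
  have e2 : (2 - n : ℝ) / 2 - 2 = -(n + 2 : ℝ) / 2 := by ring
  rw [hn, e2, e1, Real.rpow_add_one hq.ne']
  simp only [Finset.sum_const, Finset.card_univ, Fintype.card_fin, nsmul_eq_mul]
  ring

/-! ### Bound by the Newtonian potential -/

/-- The weak Laplacian of a function supported in a ball can be tested against any smooth
function. -/
theorem integral_laplacian_smul_eq {n : ℕ} {u w : EuclideanSpace ℝ (Fin n) → ℂ}
    (h : IsWeakLaplacian u w) {a : EuclideanSpace ℝ (Fin n)} {r : ℝ} (hr : 0 < r)
    (hu : ∀ᵐ x, x ∉ Metric.ball a r → u x = 0) (hw : ∀ᵐ x, x ∉ Metric.ball a r → w x = 0)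
    {φ : EuclideanSpace ℝ (Fin n) → ℝ} (hφ : ContDiff ℝ ∞ φ) :
    ∫ x, (∑ i, fderiv ℝ (fun z => fderiv ℝ φ z (EuclideanSpace.single i 1)) x
      (EuclideanSpace.single i 1)) • u x = ∫ x, φ x • w x := by
  obtain ⟨H, hH, hwH⟩ := h
  -- The cutoff is `1` on the ball, so it changes nothing where `u` and `w` live.
  let χ : ContDiffBump a := ⟨r, r + 1, hr, by linarith⟩
  let ψ : EuclideanSpace ℝ (Fin n) → ℝ := fun x => χ x * φ x
  have hψ : ContDiff ℝ ∞ ψ := χ.contDiff.mul hφ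
  have hψc : HasCompactSupport ψ := χ.hasCompactSupport.mul_right
  have hd {f : EuclideanSpace ℝ (Fin n) → ℝ} (hf : ContDiff ℝ ∞ f) (v) :
      ContDiff ℝ ∞ (fun z => fderiv ℝ f z v) :=
    (hf.fderiv_right (m := ∞) (by simp)).clm_apply contDiff_const
  have hdc {f : EuclideanSpace ℝ (Fin n) → ℝ} (hf : HasCompactSupport f) (v) :
      HasCompactSupport (fun z => fderiv ℝ f z v) := hf.fderiv_apply ℝ v
  have hEq {x} (hx : x ∈ Metric.ball a r) : ψ =ᶠ[𝓝 x] φ := by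
    filter_upwards [Metric.isOpen_ball.mem_nhds hx] with y hy
    simp [ψ, χ.one_of_mem_closedBall (Metric.ball_subset_closedBall hy)]
  have hEq2 {x} (hx : x ∈ Metric.ball a r) (v) :
      (fun z => fderiv ℝ ψ z v) =ᶠ[𝓝 x] fun z => fderiv ℝ φ z v := by
    filter_upwards [Metric.isOpen_ball.mem_nhds hx] with y hy
    rw [(hEq hy).fderiv_eq]
  have hint {f : EuclideanSpace ℝ (Fin n) → ℝ} (hf : ContDiff ℝ ∞ f) (hfc : HasCompactSupport f)
      {g : EuclideanSpace ℝ (Fin n) → ℂ} (hg : LocallyIntegrable g volume) :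
      Integrable (fun x => f x • g x) volume :=
    hg.integrable_smul_left_of_hasCompactSupport hf.continuous hfc
  have hstep (i : Fin n) : ∫ x, (fderiv ℝ (fun z => fderiv ℝ ψ z (EuclideanSpace.single i 1)) x
      (EuclideanSpace.single i 1)) • u x = ∫ x, ψ x • H i x := by
    obtain ⟨g, h1, h2⟩ := hH i
    rw [h1.2.2 _ (hd hψ _) (hdc hψc _), h2.2.2 _ hψ hψc, neg_neg]
  calc _ = ∫ x, ∑ i, (fderiv ℝ (fun z => fderiv ℝ ψ z (EuclideanSpace.single i 1)) x
      (EuclideanSpace.single i 1)) • u x := by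
        refine integral_congr_ae ?_
        filter_upwards [hu] with x hx
        by_cases hxb : x ∈ Metric.ball a r
        · rw [Finset.sum_smul]
          refine Finset.sum_congr rfl fun i _ => ?_
          rw [(hEq2 hxb _).fderiv_eq]
        · simp [hx hxb]
    _ = ∑ i, ∫ x, ψ x • H i x := by
        rw [integral_finsetSum]
        · exact Finset.sum_congr rfl fun i _ => hstep i
        · intro i _
          obtain ⟨g, h1, h2⟩ := hH i
          exact hint (hd (hd hψ _) _) (hdc (hdc hψc _) _) h1.1
    _ = ∫ x, ψ x • w x := by
        rw [← integral_finsetSum]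
        · refine integral_congr_ae ?_
          filter_upwards [hwH] with x hx
          rw [hx, Finset.smul_sum]
        · intro i _
          obtain ⟨g, h1, h2⟩ := hH i
          exact hint hψ hψc h2.2.1
    _ = _ := by
        refine integral_congr_ae ?_
        filter_upwards [hw] with x hx
        by_cases hxb : x ∈ Metric.ball a r
        · rw [(hEq hxb).eq_of_nhds]
        · simp [hx hxb]

/-- The regularized Newtonian potential identity, in the rescaled form. -/
theorem integral_kernel_smul_eq {n : ℕ} {u w : EuclideanSpace ℝ (Fin n) → ℂ}
    (h : IsWeakLaplacian u w) {a : EuclideanSpace ℝ (Fin n)} {r : ℝ} (hr : 0 < r)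
    (hu : ∀ᵐ x, x ∉ Metric.ball a r → u x = 0) (hw : ∀ᵐ x, x ∉ Metric.ball a r → w x = 0)
    {e : ℝ} (he : 0 < e) (x : EuclideanSpace ℝ (Fin n)) :
    (-(n * (n - 2) : ℝ)) • ∫ z, ((1 + ‖z‖ ^ 2) ^ (-(n + 2 : ℝ) / 2)) • u (x - e • z) =
      ∫ y, ((‖y - x‖ ^ 2 + e ^ 2) ^ ((2 - n : ℝ) / 2)) • w y := by
  have he2 : 0 < e ^ 2 := by positivity
  have hφ : ContDiff ℝ ∞ fun y : EuclideanSpace ℝ (Fin n) =>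
      (‖y - x‖ ^ 2 + e ^ 2) ^ ((2 - n : ℝ) / 2) := by
    refine ContDiff.rpow_const_of_ne ?_ fun y => by positivity
    exact ((contDiff_id.sub contDiff_const).norm_sq ℝ).add contDiff_const
  rw [← integral_laplacian_smul_eq h hr hu hw hφ]
  simp_rw [sum_fderiv_fderiv_rpow_norm_sub_sq_add x _ he2]
  -- Substitution `y = x - e z`: the Jacobian `eⁿ`, the factor `e²` and the `e^(-(n+2))` from the
  -- kernel cancel.
  have hcv : ∫ z, ((1 + ‖z‖ ^ 2) ^ (-(n + 2 : ℝ) / 2)) • u (x - e • z) =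
      ∫ y, (e ^ 2 * (‖y - x‖ ^ 2 + e ^ 2) ^ (-(n + 2 : ℝ) / 2)) • u y := by
    have h1 := integral_sub_left_eq_self (μ := (volume : Measure (EuclideanSpace ℝ (Fin n))))
      (fun y => (e ^ 2 * (‖y - x‖ ^ 2 + e ^ 2) ^ (-(n + 2 : ℝ) / 2)) • u y) x
    have h2 := Measure.integral_comp_smul_of_nonneg
      (volume : Measure (EuclideanSpace ℝ (Fin n)))
      (fun y => (e ^ 2 * (‖x - y - x‖ ^ 2 + e ^ 2) ^ (-(n + 2 : ℝ) / 2)) • u (x - y)) e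
      (hR := he.le)
    rw [h1, finrank_euclideanSpace_fin, eq_inv_smul_iff₀ (by positivity), ← integral_smul] at h2
    rw [← h2]
    refine integral_congr_ae (Eventually.of_forall fun z => ?_)
    simp only [smul_smul]
    congr 1
    have e1 : ‖x - e • z - x‖ ^ 2 + e ^ 2 = e ^ 2 * (1 + ‖z‖ ^ 2) := by
      rw [sub_sub_cancel_left, norm_neg, norm_smul, mul_pow, Real.norm_eq_abs, sq_abs]; ring
    rw [e1, Real.mul_rpow he2.le (by positivity), ← Real.rpow_natCast_mul he.le]
    have e2 : e ^ n * (e ^ 2 * e ^ ((2 : ℕ) * (-(n + 2 : ℝ) / 2))) = 1 := by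
      rw [← Real.rpow_natCast e n, ← Real.rpow_natCast e 2, ← Real.rpow_add he,
        ← Real.rpow_add he]
      convert Real.rpow_zero e using 2
      push_cast; ring
    linear_combination -((1 + ‖z‖ ^ 2) ^ (-(n + 2 : ℝ) / 2)) * e2
  rw [hcv, ← integral_smul]
  refine integral_congr_ae (Eventually.of_forall fun y => ?_)
  simp only [smul_smul]
  congr 1
  ring

/-- A compactly supported function is bounded by the Newtonian potential of its Laplacian. -/
theorem exists_enorm_le_newtonian_potential {n : ℕ} (hn : 3 ≤ n) :
    ∃ C : ℝ≥0∞, C ≠ ⊤ ∧ ∀ (u w : EuclideanSpace ℝ (Fin n) → ℂ) (a : EuclideanSpace ℝ (Fin n))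
      (r : ℝ), 0 < r → Integrable u volume → AEStronglyMeasurable w volume → IsWeakLaplacian u w →
      (∀ᵐ x, x ∉ Metric.ball a r → u x = 0) → (∀ᵐ x, x ∉ Metric.ball a r → w x = 0) →
      ∀ᵐ x, ‖u x‖ₑ ≤ C * ∫⁻ y, ‖w y‖ₑ / ‖x - y‖ₑ ^ (n - 2) := by
  let K : EuclideanSpace ℝ (Fin n) → ℝ := fun z => (1 + ‖z‖ ^ 2) ^ (-(n + 2 : ℝ) / 2)
  have hn' : (3 : ℝ) ≤ n := by exact_mod_cast hn
  have hm : 0 < (n * (n - 2) : ℝ) := mul_pos (by linarith) (by linarith)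
  have hKc : Continuous K :=
    Continuous.rpow_const (by fun_prop) fun z => Or.inl (by positivity)
  have hKp (z) : 0 < K z := Real.rpow_pos_of_pos (by positivity) _
  have hKi : Integrable K volume := by
    have := integrable_rpow_neg_one_add_norm_sq
      (μ := (volume : Measure (EuclideanSpace ℝ (Fin n)))) (r := n + 2) (by simp)
    exact this
  have hK1 (z) : ‖K z‖ ≤ 1 := by
    rw [Real.norm_of_nonneg (hKp z).le]
    exact Real.rpow_le_one_of_one_le_of_nonpos (by nlinarith [sq_nonneg ‖z‖]) (by linarith)
  have hI : 0 < ∫ z, K z := by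
    rw [integral_pos_iff_support_of_nonneg (fun z => (hKp z).le) hKi]
    have : Function.support K = univ := eq_univ_of_forall fun z => (hKp z).ne'
    rw [this]
    exact NeZero.pos _
  have hJ : (‖∫ z, K z‖ₑ * ‖(-(n * (n - 2) : ℝ))‖ₑ) ≠ 0 :=
    mul_ne_zero (enorm_ne_zero.2 hI.ne') (enorm_ne_zero.2 (neg_ne_zero.2 hm.ne'))
  have hJt : (‖∫ z, K z‖ₑ * ‖(-(n * (n - 2) : ℝ))‖ₑ) ≠ ⊤ := by finiteness
  refine ⟨(‖∫ z, K z‖ₑ * ‖(-(n * (n - 2) : ℝ))‖ₑ)⁻¹, ENNReal.inv_ne_top.2 hJ, ?_⟩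
  intro u w a r hr hui hwm hΔ hu hw
  have hmeas : AEMeasurable (fun x => ∫⁻ y, ‖w y‖ₑ / ‖x - y‖ₑ ^ (n - 2)) volume := by
    have : AEMeasurable (Function.uncurry fun x y => ‖w y‖ₑ / ‖x - y‖ₑ ^ (n - 2))
        ((volume : Measure (EuclideanSpace ℝ (Fin n))).prod volume) :=
      (hwm.comp_snd.enorm).div (by fun_prop)
    exact this.lintegral_prod_right'
  have hbd : ∀ e : ℝ, 0 < e → ∀ x, ‖∫ z, K z • u (x - e • z)‖ₑ ≤
      ‖(-(n * (n - 2) : ℝ))‖ₑ⁻¹ * ∫⁻ y, ‖w y‖ₑ / ‖x - y‖ₑ ^ (n - 2) := by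
    intro e he x
    rw [← ENNReal.div_eq_inv_mul, ENNReal.le_div_iff_mul_le
      (Or.inl (enorm_ne_zero.2 (neg_ne_zero.2 hm.ne'))) (Or.inl enorm_ne_top), mul_comm,
      ← enorm_smul, integral_kernel_smul_eq hΔ hr hu hw he x]
    refine (enorm_integral_le_lintegral_enorm _).trans (lintegral_mono fun y => ?_)
    rw [enorm_smul, mul_comm, div_eq_mul_inv]
    refine mul_le_mul' le_rfl ?_
    -- Passing to inverses avoids a separate case `y = x`, where the singular kernel is `⊤`.
    rw [ENNReal.le_inv_iff_le_inv, ← ofReal_norm (x - y), ← ENNReal.ofReal_pow (norm_nonneg _),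
      ← ofReal_norm, ← ENNReal.ofReal_inv_of_pos]
    · refine ENNReal.ofReal_le_ofReal ?_
      have hq : 0 < ‖y - x‖ ^ 2 + e ^ 2 := by positivity
      rw [Real.norm_of_nonneg (Real.rpow_nonneg hq.le _), ← Real.rpow_neg hq.le, norm_sub_rev x y]
      have e1 : ‖y - x‖ ^ (n - 2) = (‖y - x‖ ^ 2) ^ (-((2 - n : ℝ) / 2)) := by
        rw [← Real.rpow_natCast_mul (norm_nonneg _), ← Real.rpow_natCast, Nat.cast_sub (by omega)]
        congr 1; push_cast; ring
      rw [e1]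
      exact Real.rpow_le_rpow (by positivity) (by linarith [sq_nonneg e]) (by linarith)
    · exact norm_pos_iff.2 (Real.rpow_pos_of_pos (by positivity) _).ne'
  filter_upwards [ae_enorm_le_of_rescaled_convolution_le hui hKc hKi hK1
    (hmeas.const_mul _) hbd] with x hx
  rw [enorm_smul] at hx
  rw [ENNReal.mul_inv (Or.inr enorm_ne_top) (Or.inl enorm_ne_top), mul_assoc,
    ← ENNReal.div_eq_inv_mul, ENNReal.le_div_iff_mul_le (Or.inl (enorm_ne_zero.2 hI.ne'))
      (Or.inl enorm_ne_top), mul_comm]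
  exact hx

/-! ### Kato estimate and absorption -/

/-- For a function `w` living on `B(a, r)`, the Newtonian potential of `w` weighted by `V` is
controlled by the Kato modulus of `V` at scale `2r`. -/
theorem lintegral_mul_newtonian_potential_le {n : ℕ} {V w : EuclideanSpace ℝ (Fin n) → ℂ}
    (hV : AEStronglyMeasurable V volume) (hw : AEStronglyMeasurable w volume)
    {a : EuclideanSpace ℝ (Fin n)} {r : ℝ} (hw0 : ∀ᵐ x, x ∉ Metric.ball a r → w x = 0) :
    ∫⁻ x in Metric.ball a r, ‖V x‖ₑ * ∫⁻ y, ‖w y‖ₑ / ‖x - y‖ₑ ^ (n - 2) ≤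
      katoEta (2 * r) V * ∫⁻ y, ‖w y‖ₑ := by
  have hdm : Measurable fun p : EuclideanSpace ℝ (Fin n) × EuclideanSpace ℝ (Fin n) =>
      ‖p.1 - p.2‖ₑ ^ (n - 2) := by fun_prop
  calc ∫⁻ x in Metric.ball a r, ‖V x‖ₑ * ∫⁻ y, ‖w y‖ₑ / ‖x - y‖ₑ ^ (n - 2)
      = ∫⁻ x in Metric.ball a r, ∫⁻ y, ‖V x‖ₑ * (‖w y‖ₑ / ‖x - y‖ₑ ^ (n - 2)) := by
        refine lintegral_congr fun x => ?_
        rw [lintegral_const_mul' _ _ enorm_ne_top]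
    _ = ∫⁻ y, ∫⁻ x in Metric.ball a r, ‖V x‖ₑ * (‖w y‖ₑ / ‖x - y‖ₑ ^ (n - 2)) := by
        refine lintegral_lintegral_swap ?_
        exact (hV.restrict.comp_fst.enorm).mul (hw.comp_snd.enorm.div hdm.aemeasurable)
    _ ≤ ∫⁻ y, katoEta (2 * r) V * ‖w y‖ₑ := by
        refine lintegral_mono_ae ?_
        filter_upwards [hw0] with y hy
        by_cases hyb : y ∈ Metric.ball a r
        · calc ∫⁻ x in Metric.ball a r, ‖V x‖ₑ * (‖w y‖ₑ / ‖x - y‖ₑ ^ (n - 2))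
              = ∫⁻ x in Metric.ball a r, (‖V x‖ₑ / ‖y - x‖ₑ ^ (n - 2)) * ‖w y‖ₑ := by
                refine lintegral_congr fun x => ?_
                rw [← enorm_neg (x - y), neg_sub, div_eq_mul_inv, div_eq_mul_inv]
                ring
            _ = (∫⁻ x in Metric.ball a r, ‖V x‖ₑ / ‖y - x‖ₑ ^ (n - 2)) * ‖w y‖ₑ :=
                lintegral_mul_const' _ _ enorm_ne_top
            _ ≤ katoEta (2 * r) V * ‖w y‖ₑ := by
                gcongr
                -- For `y ∈ B(a, r)` one has `B(a, r) ⊆ B(y, 2r)`, whence the scale `2r`.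
                refine le_trans (lintegral_mono_set ?_) (le_iSup (fun y =>
                  ∫⁻ x in Metric.ball y (2 * r), ‖V x‖ₑ / ‖y - x‖ₑ ^ (n - 2)) y)
                refine Metric.ball_subset_ball' ?_
                rw [dist_comm]
                linarith [Metric.mem_ball.1 hyb]
        · simp [hy hyb]
    _ = katoEta (2 * r) V * ∫⁻ y, ‖w y‖ₑ := by
        rw [lintegral_const_mul'' _ hw.enorm]

/-- A solution supported in a ball on which the Kato modulus of `V` is small vanishes. -/
theorem exists_ae_eq_zero_of_mul_katoEta_lt_one {n : ℕ} (hn : 3 ≤ n) :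
    ∃ C : ℝ≥0∞, C ≠ ⊤ ∧ ∀ (V u : EuclideanSpace ℝ (Fin n) → ℂ) (a : EuclideanSpace ℝ (Fin n))
      (r : ℝ), 0 < r → AEStronglyMeasurable V volume → SolvesLaplacianIneq V u →
      essSupport u ⊆ Metric.ball a r → C * katoEta (2 * r) V < 1 → ∀ᵐ x, u x = 0 := by
  obtain ⟨C, hC, hpot⟩ := exists_enorm_le_newtonian_potential hn
  refine ⟨C, hC, fun V u a r hr hV hsol hsupp hlt => ?_⟩
  obtain ⟨w, hΔ, hle⟩ := hsol
  have hu := ae_eq_zero_of_notMem_of_essSupport_subset hsupp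
  have hw : ∀ᵐ x, x ∉ Metric.ball a r → w x = 0 := by
    filter_upwards [hu, hle] with x hx hx' hxb
    simpa [hx hxb] using hx'
  have hloc {f : EuclideanSpace ℝ (Fin n) → ℂ} (hf : LocallyIntegrable f volume)
      (hf0 : ∀ᵐ x, x ∉ Metric.ball a r → f x = 0) : Integrable f volume := by
    have h1 : IntegrableOn f (Metric.ball a r) volume :=
      (hf.integrableOn_isCompact (isCompact_closedBall a r)).mono_set Metric.ball_subset_closedBall
    exact h1.integrable_of_ae_notMem_eq_zero hf0
  have hΔ' := hΔ
  obtain ⟨H, hH, hwH⟩ := hΔ'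
  have hui : Integrable u volume := by
    -- Any index serves: local integrability of `u` is part of `HasWeakPartialDeriv`.
    obtain ⟨g, h1, -⟩ := hH ⟨0, by omega⟩
    exact hloc h1.1 hu
  have hwi : Integrable w volume := by
    have h1 : LocallyIntegrable (fun x => ∑ i, H i x) volume :=
      locallyIntegrable_finsetSum _ fun i _ => by
        obtain ⟨g, -, h2⟩ := hH i
        exact h2.2.1
    have h2 := hloc h1 (by filter_upwards [hw, hwH] with x hx hx' hxb; rw [← hx', hx hxb])
    exact h2.congr (hwH.mono fun x hx => hx.symm)
  have hub := hpot u w a r hr hui hwi.1 hΔ hu hw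
  have hself : ∫⁻ x, ‖w x‖ₑ ≤ C * katoEta (2 * r) V * ∫⁻ x, ‖w x‖ₑ := by
    calc ∫⁻ x, ‖w x‖ₑ = ∫⁻ x in Metric.ball a r, ‖w x‖ₑ := by
          rw [← lintegral_indicator Metric.isOpen_ball.measurableSet]
          refine lintegral_congr_ae ?_
          filter_upwards [hw] with x hx
          by_cases hxb : x ∈ Metric.ball a r
          · rw [indicator_of_mem hxb]
          · rw [indicator_of_notMem hxb, hx hxb, enorm_zero]
      _ ≤ ∫⁻ x in Metric.ball a r, C * (‖V x‖ₑ * ∫⁻ y, ‖w y‖ₑ / ‖x - y‖ₑ ^ (n - 2)) := by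
          refine lintegral_mono_ae (ae_restrict_of_ae ?_)
          filter_upwards [hle, hub] with x hx hx'
          calc ‖w x‖ₑ ≤ ‖V x * u x‖ₑ := enorm_le_iff_norm_le.2 hx
            _ = ‖V x‖ₑ * ‖u x‖ₑ := enorm_mul _ _
            _ ≤ ‖V x‖ₑ * (C * ∫⁻ y, ‖w y‖ₑ / ‖x - y‖ₑ ^ (n - 2)) := by gcongr
            _ = _ := by ring
      _ = C * ∫⁻ x in Metric.ball a r, ‖V x‖ₑ * ∫⁻ y, ‖w y‖ₑ / ‖x - y‖ₑ ^ (n - 2) :=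
          lintegral_const_mul' _ _ hC
      _ ≤ C * (katoEta (2 * r) V * ∫⁻ x, ‖w x‖ₑ) := by
          gcongr
          exact lintegral_mul_newtonian_potential_le hV hwi.1 hw
      _ = _ := by ring
  have hw0 : ∫⁻ x, ‖w x‖ₑ = 0 := by
    by_contra hne
    -- Absorption is legitimate because `‖w‖₁` is finite.
    refine absurd hself (not_le.2 ?_)
    conv_rhs => rw [← one_mul (∫⁻ x, ‖w x‖ₑ)]
    exact ENNReal.mul_lt_mul_left hne hwi.2.ne hlt
  have hwz : ∀ᵐ x, w x = 0 := by
    filter_upwards [(lintegral_eq_zero_iff' hwi.1.enorm).1 hw0] with x hx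
    simpa using hx
  filter_upwards [hub] with x hx
  have h0 : ∫⁻ y, ‖w y‖ₑ / ‖x - y‖ₑ ^ (n - 2) = 0 := by
    rw [← lintegral_zero (μ := (volume : Measure (EuclideanSpace ℝ (Fin n))))]
    refine lintegral_congr_ae ?_
    filter_upwards [hwz] with y hy
    simp [hy]
  rw [h0, mul_zero] at hx
  simpa using hx

end MinSupp

/-- Minimal support property for Kato class potentials: the volume of a ball containing the support
of a nontrivial solution is bounded below by a positive constant depending only on `n` and `V`. -/
theorem corollary1p2 (n : ℕ) (hn : 3 ≤ n)
    (V : EuclideanSpace ℝ (Fin n) → ℂ) (hV : MinSupp.KatoClass V) :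
    ∃ δ : ℝ, 0 < δ ∧
      ∀ (u : EuclideanSpace ℝ (Fin n) → ℂ) (a : EuclideanSpace ℝ (Fin n)) (r : ℝ), 0 < r →
        MinSupp.MemSobolevW 2 2 u →
        MinSupp.SolvesLaplacianIneq V u →
        MinSupp.essSupport u ⊆ Metric.ball a r →
        ¬ (∀ᵐ x ∂volume, u x = 0) →
        ENNReal.ofReal δ ≤ volume (Metric.ball a r) := by
  obtain ⟨C, hC, hvanish⟩ := MinSupp.exists_ae_eq_zero_of_mul_katoEta_lt_one hn
  have hlim : Tendsto (fun r : ℝ => C * MinSupp.katoEta r V) (𝓝[>] 0) (𝓝 0) := by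
    simpa using ENNReal.Tendsto.const_mul hV.2 (Or.inr hC)
  -- `C η(s, V) < 1` for `0 < s < ρ`; taking `s = 2r` excludes `r < ρ / 2`, hence `δ = |B(0, ρ /
  -- 2)|`.
  obtain ⟨ρ, hρ, hsmall⟩ := mem_nhdsGT_iff_exists_Ioo_subset.1
    (hlim.eventually (gt_mem_nhds (zero_lt_one (α := ℝ≥0∞))))
  have hρ' : 0 < ρ := hρ
  refine ⟨(volume (Metric.ball (0 : EuclideanSpace ℝ (Fin n)) (ρ / 2))).toReal,
    ENNReal.toReal_pos (Metric.measure_ball_pos _ _ (by linarith)).ne' measure_ball_lt_top.ne, ?_⟩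
  intro u a r hr _ hsol hsupp hne
  rw [ENNReal.ofReal_toReal measure_ball_lt_top.ne]
  have hρr : ρ / 2 ≤ r := by
    by_contra! hlt
    exact hne (hvanish V u a r hr hV.1.aestronglyMeasurable hsol hsupp
      (hsmall ⟨by linarith, by linarith⟩))
  rw [← Measure.addHaar_ball_center volume a (ρ / 2)]
  exact measure_mono (Metric.ball_subset_ball hρr)
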